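/- Let $q$ be an odd prime power and let $m\ge 2$ be an even integer. Let $\mathfrak G_{m,q}$ be the graph whose vertices are the points of the affine space $AG(m,q)=\mathbb F_q^m$, two distinct points $x,y$ being adjacent if and only if $\sum_{i=1}^m (x_i-y_i)^2$ is a square in $\mathbb F_q$ (zero included). Then $\mathfrak G_{m,q}$ is strongly regular with parameters $(v,k,\lambda,\mu)$, i.e. it has $v$ vertices, every vertex has exactly $k$ neighbours, every two adjacent vertices have exactly $\lambda$ common neighbours, and every two distinct non-adjacent vertices have exactly $\mu$ common neighbours, where $$v=q^m,$$ $$k=\begin{cases}\frac12\left(q^m+q^{m-1}+q^{m/2}-q^{m/2-1}\right)-1, & q\equiv 1 \pmod 4,\\[2pt] \frac12\left(q^m+q^{m-1}+(-q)^{m/2}+(-q)^{m/2-1}\right)-1, & q\equiv 3 \pmod 4,\end{cases}$$ $$\lambda=\frac14\left(q^{m-2}(q+1)^2+2(-1)^{m(q-1)/4}q^{m/2-1}(q-1)\right)-2,$$ $$\mu=\begin{cases}\frac14 q^{m/2-1}(q+1)\left(q^{m/2}+q^{m/2-1}+2\right), & q\equiv 1 \pmod 4,\\[2pt] \frac14 q^{m/2-1}(q+1)\left(q^{m/2}+q^{m/2-1}+2(-1)^{m/2}\right),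 & q\equiv 3 \pmod 4.\end{cases}$$ -/

import Mathlib

namespace KurzMeyer

/-- The (formal) squared Euclidean distance `∑ᵢ (xᵢ - yᵢ)²` of two points of `AG(m, F)`. -/
def sqDist {F : Type*} [Field F] {m : ℕ} (x y : Fin m → F) : F :=
  ∑ i, (x i - y i) ^ 2

theorem sqDist_comm {F : Type*} [Field F] {m : ℕ} (x y : Fin m → F) :
    sqDist x y = sqDist y x :=
  Finset.sum_congr rfl fun i _ => by ring

/-- The graph on the points of `AG(m, F)` in which two distinct points are adjacent when their
squared distance is a square of `F` (zero counts as a square). -/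
def integralGraph (F : Type*) [Field F] (m : ℕ) : SimpleGraph (Fin m → F) where
  Adj x y := x ≠ y ∧ IsSquare (sqDist x y)
  symm := ⟨fun x y h => ⟨h.1.symm, sqDist_comm x y ▸ h.2⟩⟩
  loopless := ⟨fun _ h => h.1 rfl⟩

/-- The valency `k`, as a rational number (used for even `m ≥ 2` and odd `q`). -/
def paramK (m q : ℕ) : ℚ :=
  if q % 4 = 1 then
    1 / 2 * ((q : ℚ) ^ m + (q : ℚ) ^ (m - 1) + (q : ℚ) ^ (m / 2) - (q : ℚ) ^ (m / 2 - 1)) - 1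
  else
    1 / 2 * ((q : ℚ) ^ m + (q : ℚ) ^ (m - 1) + (-(q : ℚ)) ^ (m / 2)
      + (-(q : ℚ)) ^ (m / 2 - 1)) - 1

/-- The parameter `λ`; the exponent `m (q - 1) / 4` is an integer for even `m` and odd `q`. -/
def paramLambda (m q : ℕ) : ℚ :=
  1 / 4 * ((q : ℚ) ^ (m - 2) * ((q : ℚ) + 1) ^ 2
    + 2 * (-1) ^ (m * (q - 1) / 4) * (q : ℚ) ^ (m / 2 - 1) * ((q : ℚ) - 1)) - 2

/-- The parameter `μ`. -/
def paramMu (m q : ℕ) : ℚ :=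
  if q % 4 = 1 then
    1 / 4 * (q : ℚ) ^ (m / 2 - 1) * ((q : ℚ) + 1)
      * ((q : ℚ) ^ (m / 2) + (q : ℚ) ^ (m / 2 - 1) + 2)
  else
    1 / 4 * (q : ℚ) ^ (m / 2 - 1) * ((q : ℚ) + 1)
      * ((q : ℚ) ^ (m / 2) + (q : ℚ) ^ (m / 2 - 1) + 2 * (-1) ^ (m / 2))

end KurzMeyer

/-!
Write `z ⬝ᵥ z` for the sum of the squares of the coordinates of `z`, let `S` be the set of vectors
`z` for which it is a square, and let `f` be the indicator function of `S`. Adjacency of distinct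
points means that their difference lies in `S`, so the valency is `|S| - 1`, and the number of
common neighbours of `x ≠ y` is the value of the convolution `f * f` at `d = x - y`, less the two
contributions of `x` and `y` themselves when these are adjacent.

Both quantities come from the Fourier transform of `f` with respect to a primitive additive
character `ψ` of `F`. The indicator function of the squares of `F` has an explicit Fourier
expansion in terms of the quadratic character and its Gauss sum (`two_mul_squareInd_eq_sum`).
Completing the square evaluates the quadratic exponential sum
`∑ z, ψ (s * (z ⬝ᵥ z) + w ⬝ᵥ z)` (`sum_addChar_quadForm`). In even dimension `m` only the `m`-th
power of the Gauss sum enters, and its value is `ε * q ^ (m / 2)` with `ε = χ (-1) ^ (m / 2)`; in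
particular the dependence on the sign `χ s` disappears. Together these show that, up to a multiple
of the indicator function of the origin, the transform of `f` at `w` is an affine function of the
indicator of `-(w ⬝ᵥ w)` being a square (`sum_squareInd_mul_addChar`).

At the origin this gives `|S|`. Away from the origin the transform takes only two values, so it is a
root of a quadratic polynomial there; as squaring the transform corresponds to convolution, Fourier
inversion makes `f * f` an affine function of `f` off the origin (`sum_squareInd_mul_squareInd`).
Hence the number of common neighbours depends only on whether the two points are adjacent.
-/

namespace KurzMeyer

open Finset

/-! ### Quadratic exponential sums -/

section Fourier

variable {F : Type*} [Field F] {K : Type*} [Field K] {ι : Type*} [Fintype ι]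

theorem addChar_sum_eq_prod (ψ : AddChar F K) (f : ι → F) : ψ (∑ i, f i) = ∏ i, ψ (f i) :=
  map_prod ψ.toMonoidHom (fun i => Multiplicative.ofAdd (f i)) univ

/-- An exponential sum whose phase splits over the coordinates is a product of one-variable sums. -/
theorem sum_addChar_sum (ψ : AddChar F K) [Fintype F] [DecidableEq ι] (h : ι → F → F) :
    ∑ z : ι → F, ψ (∑ i, h i (z i)) = ∏ i, ∑ x, ψ (h i x) := by
  rw [prod_univ_sum, Fintype.piFinset_univ]
  exact sum_congr rfl fun z _ => addChar_sum_eq_prod _ _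

variable [Fintype F] [DecidableEq F]

/-- Orthogonality of the characters `z ↦ ψ (w ⬝ᵥ z)`. -/
theorem sum_addChar_dotProduct [DecidableEq ι] {ψ : AddChar F K} (hψ : ψ.IsPrimitive) (z : ι → F) :
    ∑ w : ι → F, ψ (w ⬝ᵥ z) = if z = 0 then (Fintype.card F : K) ^ Fintype.card ι else 0 := by
  simp only [dotProduct]
  rw [sum_addChar_sum ψ fun i x => x * z i]
  simp only [AddChar.sum_mulShift _ hψ]
  split_ifs with h
  · simp [h]
  · obtain ⟨i, hi⟩ := Function.ne_iff.mp h
    exact prod_eq_zero (mem_univ i) (by rw [if_neg (by simpa using hi), Nat.cast_zero])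

/-- The quadratic Gauss sum `∑ a, χ a * ψ a`, where `χ` is the quadratic character of `F` with
values read in `K`. -/
noncomputable def quadGauss (ψ : AddChar F K) : K :=
  gaussSum ((quadraticChar F).ringHomComp (Int.castRingHom K)) ψ

theorem sum_quadraticChar_mul_addChar (hF : ringChar F ≠ 2) (ψ : AddChar F K) (t : F) :
    ∑ s, (quadraticChar F s : K) * ψ (s * t) = quadraticChar F t * quadGauss ψ := by
  rcases eq_or_ne t 0 with rfl | ht
  · simp only [mul_zero, AddChar.map_zero_eq_one, mul_one, ← Int.cast_sum,
      quadraticChar_sum_zero hF, MulChar.map_zero, Int.cast_zero, zero_mul]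
  · have h := gaussSum_mulShift ((quadraticChar F).ringHomComp (Int.castRingHom K)) ψ
      (Units.mk0 t ht)
    have h2 : (quadraticChar F t : K) * quadraticChar F t = 1 := by
      have := quadraticChar_sq_one ht
      rw [← Int.cast_mul, ← sq, this, Int.cast_one]
    rw [quadGauss, ← h]
    simp only [gaussSum, Units.val_mk0, MulChar.ringHomComp_apply, eq_intCast,
      AddChar.mulShift_apply]
    rw [← mul_assoc, h2, one_mul]
    exact sum_congr rfl fun s _ => by rw [mul_comm t s]

theorem sum_addChar_mul_sq (hF : ringChar F ≠ 2) {ψ : AddChar F K} (hψ : ψ.IsPrimitive) {s : F}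
    (hs : s ≠ 0) : ∑ x, ψ (s * x ^ 2) = quadraticChar F s * quadGauss ψ := by
  -- each `t` has `χ t + 1` square roots
  have h : ∀ t : F, ∑ x with x ^ 2 = t, ψ (s * x ^ 2)
      = ((quadraticChar F t : K) + 1) * ψ (t * s) := by
    intro t
    have := quadraticChar_card_sqrts hF t
    rw [sum_congr rfl (g := fun _ => ψ (t * s)), sum_const, nsmul_eq_mul]
    · congr 1
      rw [← Int.cast_one, ← Int.cast_add, ← this, Int.cast_natCast]
      congr 2
      ext x; simp
    · intro x hx
      rw [← (mem_filter.mp hx).2, mul_comm]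
  rw [← sum_fiberwise univ (fun x : F => x ^ 2), sum_congr rfl fun t _ => h t]
  simp only [add_mul, one_mul, sum_add_distrib, sum_quadraticChar_mul_addChar hF,
    AddChar.sum_mulShift s hψ, hs, if_false, Nat.cast_zero, add_zero]

theorem sum_addChar_quadratic (hF : ringChar F ≠ 2) {ψ : AddChar F K} (hψ : ψ.IsPrimitive)
    {s : F} (hs : s ≠ 0) (w : F) :
    ∑ x, ψ (s * x ^ 2 + w * x) = ψ (-(w ^ 2) / (4 * s)) * (quadraticChar F s * quadGauss ψ) := by
  have h2 : (2 : F) ≠ 0 := Ring.two_ne_zero hF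
  have h4 : (4 : F) ≠ 0 := by
    rw [show (4 : F) = 2 * 2 by norm_num]; exact mul_ne_zero h2 h2
  -- complete the square
  rw [← sum_addChar_mul_sq hF hψ hs, mul_sum,
    ← Equiv.sum_comp (Equiv.addRight (-(w / (2 * s))))]
  refine sum_congr rfl fun x _ => ?_
  rw [← AddChar.map_add_eq_mul]
  congr 1
  simp only [Equiv.coe_addRight]
  rw [show (4 : F) = 2 * 2 by norm_num]
  field_simp
  ring

variable [CharZero K]

theorem quadGauss_sq (hF : ringChar F ≠ 2) {ψ : AddChar F K} (hψ : ψ.IsPrimitive) :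
    quadGauss ψ ^ 2 = (quadraticChar F (-1) : K) * (Fintype.card F : K) := by
  have h1 : (quadraticChar F).ringHomComp (Int.castRingHom K) ≠ 1 :=
    (MulChar.ringHomComp_ne_one_iff (RingHom.injective_int _)).mpr (quadraticChar_ne_one hF)
  have h2 : ((quadraticChar F).ringHomComp (Int.castRingHom K)).IsQuadratic :=
    (quadraticChar_isQuadratic F).comp _
  exact gaussSum_sq h1 h2 hψ

theorem quadGauss_ne_zero (hF : ringChar F ≠ 2) {ψ : AddChar F K} (hψ : ψ.IsPrimitive) :
    quadGauss ψ ≠ 0 := by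
  have h := quadGauss_sq hF hψ
  have h1 : quadraticChar F (-1) ≠ 0 := by
    rw [Ne, quadraticChar_eq_zero_iff]; simp
  intro h0
  rw [h0] at h
  have := mul_ne_zero (Int.cast_ne_zero (α := K).mpr h1)
    (Nat.cast_ne_zero (R := K).mpr (Fintype.card_ne_zero (α := F)))
  simp_all

/-- In even dimension `2 n` the one-variable factors contribute the even power
`(χ s * g) ^ (2 n) = (χ (-1) * q) ^ n`, in which the sign `χ s` is lost; here `χ` is the quadratic
character, `g` its Gauss sum and `q` the order of `F`. -/
theorem sum_addChar_quadForm [DecidableEq ι] (hF : ringChar F ≠ 2) {ψ : AddChar F K}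
    (hψ : ψ.IsPrimitive) {n : ℕ} (hn : Fintype.card ι = 2 * n) {s : F} (hs : s ≠ 0) (w : ι → F) :
    ∑ z : ι → F, ψ (s * (z ⬝ᵥ z) + w ⬝ᵥ z)
      = (quadraticChar F (-1) : K) ^ n * (Fintype.card F : K) ^ n
        * ψ (-(w ⬝ᵥ w) / (4 * s)) := by
  have h : ∀ z : ι → F, s * (z ⬝ᵥ z) + w ⬝ᵥ z = ∑ i, (s * z i ^ 2 + w i * z i) := fun z => by
    simp only [dotProduct, mul_sum, sum_add_distrib, sq]
  have hsq : (quadraticChar F s : K) ^ 2 = 1 := by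
    rw [← Int.cast_pow, quadraticChar_sq_one hs, Int.cast_one]
  simp only [h]
  rw [sum_addChar_sum ψ fun i x => s * x ^ 2 + w i * x]
  simp only [sum_addChar_quadratic hF hψ hs, prod_mul_distrib, prod_const, card_univ, hn,
    ← addChar_sum_eq_prod]
  rw [← mul_pow, pow_mul, mul_pow, hsq, quadGauss_sq hF hψ, one_mul, mul_pow, mul_comm]
  congr 2
  simp only [dotProduct, sq, neg_div, sum_div, sum_neg_distrib]

end Fourier

/-! ### The Fourier transform of the set of vectors of square norm -/

section Transform

variable {F : Type*} [Field F] {K : Type*} [Field K]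

open Classical in
/-- The indicator function of the squares of `F` (zero included), with values in `K`. -/
noncomputable def squareInd (K : Type*) [Field K] (t : F) : K := if IsSquare t then 1 else 0

theorem squareInd_eq_one_or_zero (t : F) : squareInd K t = 1 ∨ squareInd K t = 0 := by
  unfold squareInd; split_ifs <;> simp

variable [Fintype F] [DecidableEq F]

theorem two_mul_squareInd (t : F) :
    2 * squareInd K t = 1 + quadraticChar F t + if t = 0 then 1 else 0 := by
  rcases eq_or_ne t 0 with rfl | ht
  · simp only [squareInd, IsSquare.zero, if_true, MulChar.map_zero, Int.cast_zero]; norm_num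
  · simp only [squareInd, ht, if_false]
    split_ifs with h
    · rw [(quadraticChar_one_iff_isSquare ht).mpr h]; norm_num
    · rw [quadraticChar_neg_one_iff_not_isSquare.mpr h]; norm_num

variable [CharZero K] {ι : Type*} [Fintype ι] [DecidableEq ι]

/-- Fourier expansion of the indicator function of the squares. -/
theorem two_mul_squareInd_eq_sum (hF : ringChar F ≠ 2) {ψ : AddChar F K} (hψ : ψ.IsPrimitive)
    (t : F) :
    2 * squareInd K t = 1 + ∑ s, (1 / (Fintype.card F : K) + quadraticChar F s / quadGauss ψ)
      * ψ (s * t) := by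
  have hq : (Fintype.card F : K) ≠ 0 := Nat.cast_ne_zero.mpr Fintype.card_ne_zero
  have hg := quadGauss_ne_zero hF hψ
  have h1 : ∑ s, (quadraticChar F s / quadGauss ψ) * ψ (s * t) = quadraticChar F t := by
    simp only [div_mul_eq_mul_div, ← sum_div]
    rw [sum_quadraticChar_mul_addChar hF, mul_div_cancel_right₀ _ hg]
  have h2 : ∑ s, 1 / (Fintype.card F : K) * ψ (s * t) = if t = 0 then 1 else 0 := by
    rw [← mul_sum, AddChar.sum_mulShift t hψ]
    split_ifs
    · rw [one_div, inv_mul_cancel₀ hq]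
    · simp
  rw [two_mul_squareInd]
  simp only [add_mul, sum_add_distrib]
  rw [h1, h2]
  ring

/-- The Fourier transform of the indicator function of `{z | z ⬝ᵥ z is a square}`, in even
dimension `2 (p + 1)`. Off the origin it takes only two values. -/
theorem sum_squareInd_mul_addChar (hF : ringChar F ≠ 2) {ψ : AddChar F K} (hψ : ψ.IsPrimitive)
    {p : ℕ} (hn : Fintype.card ι = 2 * (p + 1)) (w : ι → F) :
    ∑ z : ι → F, squareInd K (z ⬝ᵥ z) * ψ (w ⬝ᵥ z)
      = (if w = 0 then (Fintype.card F : K) ^ (2 * p + 1) * (Fintype.card F + 1) / 2 else 0)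
        + (quadraticChar F (-1) : K) ^ (p + 1) * (Fintype.card F : K) ^ p
          * (Fintype.card F * squareInd K (-(w ⬝ᵥ w)) - (Fintype.card F + 1) / 2) := by
  have hq : (Fintype.card F : K) ≠ 0 := Nat.cast_ne_zero.mpr Fintype.card_ne_zero
  have h4 : (4 : F) ≠ 0 := by
    have h2 : (2 : F) ≠ 0 := Ring.two_ne_zero hF
    rw [show (4 : F) = 2 * 2 by norm_num]; exact mul_ne_zero h2 h2
  have hχ4 : quadraticChar F 4 = 1 := by
    rw [show (4 : F) = 2 ^ 2 by norm_num]
    exact quadraticChar_sq_one' (Ring.two_ne_zero hF)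
  set q : K := (Fintype.card F : K) with hqdef
  set e : K := (quadraticChar F (-1) : K) ^ (p + 1) with he
  set c : F → K := fun s => 1 / q + quadraticChar F s / quadGauss ψ with hc
  have hc0 : c 0 = 1 / q := by simp [hc]
  have hψ0 : ∑ z : ι → F, ψ (w ⬝ᵥ z) = if w = 0 then q ^ (2 * (p + 1)) else 0 := by
    rw [← hn, ← sum_addChar_dotProduct hψ w]
    exact sum_congr rfl fun z _ => by rw [dotProduct_comm]
  -- interchange the sum over `z` with the Fourier expansion of `squareInd`
  have h1 : 2 * ∑ z : ι → F, squareInd K (z ⬝ᵥ z) * ψ (w ⬝ᵥ z)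
      = ∑ z : ι → F, ψ (w ⬝ᵥ z)
        + ∑ s, c s * ∑ z : ι → F, ψ (s * (z ⬝ᵥ z) + w ⬝ᵥ z) := by
    simp only [mul_sum]
    rw [sum_comm, ← sum_add_distrib]
    refine sum_congr rfl fun z _ => ?_
    rw [← mul_assoc, two_mul_squareInd_eq_sum hF hψ, add_mul, one_mul, sum_mul]
    congr 1
    exact sum_congr rfl fun s _ => by rw [AddChar.map_add_eq_mul, mul_assoc]
  -- the substitution `s ↦ 1 / (4 s)` turns the nonzero frequencies into the expansion of
  -- `squareInd` at `-(w ⬝ᵥ w)`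
  have h2 : ∑ s ∈ univ.erase (0 : F), c s * ψ (-(w ⬝ᵥ w) / (4 * s))
      = ∑ s ∈ univ.erase (0 : F), c s * ψ (s * -(w ⬝ᵥ w)) := by
    refine sum_nbij' (fun s => 1 / (4 * s)) (fun s => 1 / (4 * s)) ?_ ?_ ?_ ?_ ?_
    · intro s hs; simpa [h4] using hs
    · intro s hs; simpa [h4] using hs
    · intro s hs
      have : s ≠ 0 := by simpa using hs
      field_simp
    · intro s hs
      have : s ≠ 0 := by simpa using hs
      field_simp
    · intro s hs
      have hs0 : s ≠ 0 := by simpa using hs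
      have h3 : quadraticChar F (1 / (4 * s)) = quadraticChar F s := by
        have h5 : quadraticChar F (1 / (4 * s)) * quadraticChar F (4 * s) = 1 := by
          rw [← map_mul, one_div, inv_mul_cancel₀ (mul_ne_zero h4 hs0), map_one]
        rw [map_mul, hχ4, one_mul] at h5
        have h6 := quadraticChar_sq_one hs0
        calc _ = quadraticChar F (1 / (4 * s)) * quadraticChar F s ^ 2 := by rw [h6, mul_one]
          _ = _ := by rw [sq, ← mul_assoc, h5, one_mul]
      simp only [hc, h3]
      congr 2
      ring
  have h3 : ∑ s ∈ univ.erase (0 : F), c s * ψ (s * -(w ⬝ᵥ w))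
      = 2 * squareInd K (-(w ⬝ᵥ w)) - 1 - 1 / q := by
    have h := two_mul_squareInd_eq_sum hF hψ (-(w ⬝ᵥ w))
    rw [← add_sum_erase univ _ (mem_univ (0 : F))] at h
    rw [h, MulChar.map_zero, zero_mul, AddChar.map_zero_eq_one]
    simp only [hc, Int.cast_zero, zero_div, add_zero, mul_one]
    ring
  have h4 : ∑ s, c s * ∑ z : ι → F, ψ (s * (z ⬝ᵥ z) + w ⬝ᵥ z)
      = 1 / q * (if w = 0 then q ^ (2 * (p + 1)) else 0)
        + e * q ^ (p + 1) * (2 * squareInd K (-(w ⬝ᵥ w)) - 1 - 1 / q) := by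
    rw [← add_sum_erase univ _ (mem_univ (0 : F)), ← h3, ← h2, hc0, ← hψ0]
    congr 1
    · simp only [zero_mul, zero_add]
    · rw [mul_sum]
      refine sum_congr rfl fun s hs => ?_
      rw [sum_addChar_quadForm hF hψ hn (ne_of_mem_erase hs)]
      ring
  rw [h4, hψ0] at h1
  have h2' : (2 : K) ≠ 0 := two_ne_zero
  refine mul_left_cancel₀ h2' (h1.trans ?_)
  split_ifs
  · field_simp
    ring
  · field_simp
    ring

/-- The values of the convolution square of the indicator function of
`{z | z ⬝ᵥ z is a square}` away from the origin. Since its Fourier transform takes two values off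
the origin, that transform satisfies a quadratic equation there, and Fourier inversion turns this
into an affine relation between the function and its convolution square. -/
theorem sum_squareInd_mul_squareInd (hF : ringChar F ≠ 2) {ψ : AddChar F K}
    (hψ : ψ.IsPrimitive) {p : ℕ} (hn : Fintype.card ι = 2 * (p + 1)) {d : ι → F} (hd : d ≠ 0) :
    4 * ∑ z : ι → F, squareInd K (z ⬝ᵥ z) * squareInd K ((d - z) ⬝ᵥ (d - z))
      = (Fintype.card F : K) ^ (2 * p) * (Fintype.card F + 1) ^ 2
        + 2 * (quadraticChar F (-1) : K) ^ (p + 1) * (Fintype.card F : K) ^ p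
          * (Fintype.card F + 1 - 2 * squareInd K (d ⬝ᵥ d)) := by
  have hq : (Fintype.card F : K) ≠ 0 := Nat.cast_ne_zero.mpr Fintype.card_ne_zero
  have he : ((quadraticChar F (-1) : K) ^ (p + 1)) ^ 2 = 1 := by
    rw [← pow_mul, mul_comm, pow_mul, ← Int.cast_pow, quadraticChar_sq_one (by simp),
      Int.cast_one, one_pow]
  have hft := fun w : ι → F => sum_squareInd_mul_addChar hF hψ hn w
  set q : K := (Fintype.card F : K) with hqdef
  set e : K := (quadraticChar F (-1) : K) ^ (p + 1)
  set f : (ι → F) → K := fun z => squareInd K (z ⬝ᵥ z) with hf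
  set g : (ι → F) → K := fun w => ∑ z, f z * ψ (w ⬝ᵥ z) with hg
  have horth : ∀ z : ι → F, ∑ w : ι → F, ψ (w ⬝ᵥ z) = if z = 0 then q ^ (2 * (p + 1)) else 0 :=
    fun z => by rw [← hn]; exact sum_addChar_dotProduct hψ z
  -- `g` is the Fourier transform of `f`; `h1` is Fourier inversion for `f`, and `h2` for the
  -- convolution square of `f`
  have h0 : ∑ w : ι → F, ψ (-(w ⬝ᵥ d)) = 0 := by
    have := horth (-d)
    rw [if_neg (neg_ne_zero.mpr hd)] at this
    simpa only [dotProduct_neg] using this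
  have h1 : ∑ w, g w * ψ (-(w ⬝ᵥ d)) = q ^ (2 * (p + 1)) * f d := by
    simp only [hg, sum_mul]
    rw [sum_comm]
    have : ∀ z, ∑ w : ι → F, f z * ψ (w ⬝ᵥ z) * ψ (-(w ⬝ᵥ d))
        = if z = d then q ^ (2 * (p + 1)) * f d else 0 := fun z => by
      have h := horth (z + -d)
      simp only [dotProduct_add, dotProduct_neg, AddChar.map_add_eq_mul, add_neg_eq_zero] at h
      simp only [mul_assoc, ← mul_sum]
      rw [h]
      split_ifs with hz
      · rw [hz, mul_comm]
      · simp
    simp only [this, sum_ite_eq', mem_univ, if_true]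
  have h2 : ∑ w, g w ^ 2 * ψ (-(w ⬝ᵥ d)) = q ^ (2 * (p + 1)) * ∑ z, f z * f (d - z) := by
    simp only [hg]
    simp only [sq, sum_mul_sum]
    simp only [sum_mul]
    rw [sum_comm, mul_sum]
    refine sum_congr rfl fun z _ => ?_
    rw [sum_comm]
    have : ∀ y, ∑ w : ι → F, f z * ψ (w ⬝ᵥ z) * (f y * ψ (w ⬝ᵥ y)) * ψ (-(w ⬝ᵥ d))
        = if y = d - z then q ^ (2 * (p + 1)) * (f z * f (d - z)) else 0 := fun y => by
      have h := horth (z + y + -d)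
      simp only [dotProduct_add, dotProduct_neg, AddChar.map_add_eq_mul] at h
      rw [sum_congr rfl fun w _ => show _ = f z * f y * (ψ (w ⬝ᵥ z) * ψ (w ⬝ᵥ y)
        * ψ (-(w ⬝ᵥ d))) by ring, ← mul_sum, h]
      have hiff : z + y + -d = 0 ↔ y = d - z := by
        rw [← sub_eq_add_neg, sub_eq_zero, eq_sub_iff_add_eq']
      simp only [hiff]
      split_ifs with hy
      · rw [hy, mul_comm]
      · simp
    simp only [this, sum_ite_eq', mem_univ, if_true]
  set A : K := q ^ (2 * p + 1) * (q + 1) / 2 with hA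
  -- off the origin `g` takes the values `e * q ^ p * (q - 1) / 2` and `-e * q ^ p * (q + 1) / 2`,
  -- with sum `-e * q ^ p` and product `-q ^ (2 * p) * (q ^ 2 - 1) / 4`
  have hquad : ∀ w, g w ^ 2 = -(e * q ^ p) * g w + q ^ (2 * p) * (q ^ 2 - 1) / 4
      + if w = 0 then A ^ 2 + A * e * q ^ (p + 1) else 0 := fun w => by
    rw [hg]
    simp only
    rw [hft w]
    by_cases hw : w = 0
    · have : squareInd K (-(w ⬝ᵥ w)) = 1 := by simp [hw, squareInd]
      rw [this, if_pos hw, if_pos hw]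
      linear_combination (q ^ (2 * p) * (q - 1) ^ 2 / 4 + q ^ (2 * p) * (q - 1) / 2) * he
    · rw [if_neg hw, if_neg hw]
      rcases squareInd_eq_one_or_zero (K := K) (-(w ⬝ᵥ w)) with h | h <;> rw [h]
      · linear_combination (q ^ (2 * p) * (q - 1) ^ 2 / 4 + q ^ (2 * p) * (q - 1) / 2) * he
      · linear_combination (q ^ (2 * p) * (q + 1) ^ 2 / 4 - q ^ (2 * p) * (q + 1) / 2) * he
  have h3 : ∑ w, g w ^ 2 * ψ (-(w ⬝ᵥ d))
      = -(e * q ^ p) * (q ^ (2 * (p + 1)) * f d) + (A ^ 2 + A * e * q ^ (p + 1)) := by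
    simp only [hquad, add_mul, sum_add_distrib, mul_assoc, ← mul_sum]
    rw [← mul_assoc, ← h1, h0]
    simp [mul_assoc]
  have h4 := h2.symm.trans h3
  refine mul_left_cancel₀ (pow_ne_zero (2 * (p + 1)) hq) ?_
  simp only [hA] at h4
  linear_combination 4 * h4

theorem sum_squareInd (hF : ringChar F ≠ 2) {ψ : AddChar F K} (hψ : ψ.IsPrimitive)
    {p : ℕ} (hn : Fintype.card ι = 2 * (p + 1)) :
    2 * ∑ z : ι → F, squareInd K (z ⬝ᵥ z)
      = (Fintype.card F : K) ^ (2 * p + 1) * (Fintype.card F + 1)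
        + (quadraticChar F (-1) : K) ^ (p + 1) * (Fintype.card F : K) ^ p
          * (Fintype.card F - 1) := by
  have h := sum_squareInd_mul_addChar hF hψ hn (0 : ι → F)
  simp only [zero_dotProduct, AddChar.map_zero_eq_one, mul_one, if_true, neg_zero] at h
  rw [h]
  simp only [squareInd, IsSquare.zero, if_true]
  ring

end Transform

/-! ### Counting vectors -/

section Counting

variable {F : Type*} [Field F] [Fintype F] [DecidableEq F] {ι : Type*} [Fintype ι] [DecidableEq ι]

/-- A finite field has a primitive additive character with values in some
field of characteristic zero. -/
theorem exists_isPrimitive_addChar (F : Type*) [Field F] [Fintype F] :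
    ∃ (K : Type) (_ : Field K) (_ : CharZero K) (ψ : AddChar F K), ψ.IsPrimitive := by
  have h : ringChar ℚ ≠ ringChar F := by
    rw [ringChar.eq_zero]
    exact (CharP.ringChar_ne_zero_of_finite F).symm
  let ψ := AddChar.FiniteField.primitiveChar F ℚ h
  exact ⟨CyclotomicField ψ.n ℚ, inferInstance, inferInstance, ψ.char, ψ.prim⟩

theorem two_mul_ncard_isSquare (hF : ringChar F ≠ 2) {p : ℕ}
    (hn : Fintype.card ι = 2 * (p + 1)) :
    2 * ({z : ι → F | IsSquare (z ⬝ᵥ z)}.ncard : ℤ)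
      = (Fintype.card F : ℤ) ^ (2 * p + 1) * (Fintype.card F + 1)
        + quadraticChar F (-1) ^ (p + 1) * (Fintype.card F : ℤ) ^ p * (Fintype.card F - 1) := by
  obtain ⟨K, _, _, ψ, hψ⟩ := exists_isPrimitive_addChar F
  have h := sum_squareInd hF hψ hn
  have hc : ∑ z : ι → F, squareInd K (z ⬝ᵥ z)
      = ({z : ι → F | IsSquare (z ⬝ᵥ z)}.ncard : K) := by
    classical
    rw [Set.ncard_eq_toFinset_card', Set.toFinset_ofPred, Finset.natCast_card_filter]
    exact Finset.sum_congr rfl fun z _ => by unfold squareInd; congr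
  rw [hc] at h
  exact_mod_cast h

theorem four_mul_ncard_isSquare_and_isSquare (hF : ringChar F ≠ 2) {p : ℕ}
    (hn : Fintype.card ι = 2 * (p + 1)) {d : ι → F} (hd : d ≠ 0) [Decidable (IsSquare (d ⬝ᵥ d))] :
    4 * ({z : ι → F | IsSquare (z ⬝ᵥ z) ∧ IsSquare ((d - z) ⬝ᵥ (d - z))}.ncard : ℤ)
      = (Fintype.card F : ℤ) ^ (2 * p) * (Fintype.card F + 1) ^ 2
        + 2 * quadraticChar F (-1) ^ (p + 1) * (Fintype.card F : ℤ) ^ p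
          * (Fintype.card F + 1 - 2 * if IsSquare (d ⬝ᵥ d) then 1 else 0) := by
  obtain ⟨K, _, _, ψ, hψ⟩ := exists_isPrimitive_addChar F
  have h := sum_squareInd_mul_squareInd hF hψ hn hd
  have hc : ∑ z : ι → F, squareInd K (z ⬝ᵥ z) * squareInd K ((d - z) ⬝ᵥ (d - z))
      = ({z : ι → F | IsSquare (z ⬝ᵥ z) ∧ IsSquare ((d - z) ⬝ᵥ (d - z))}.ncard : K) := by
    classical
    simp only [squareInd, ← ite_and, mul_ite, mul_one, mul_zero, Finset.sum_boole,
      Set.ncard_eq_toFinset_card', Set.toFinset_ofPred, and_comm]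
  have hi : squareInd K (d ⬝ᵥ d) = ((if IsSquare (d ⬝ᵥ d) then 1 else 0 : ℤ) : K) := by
    unfold squareInd; split_ifs <;> simp
  rw [hc, hi] at h
  exact_mod_cast h

/-- If `z ⬝ᵥ z` were always a square, comparing `two_mul_ncard_isSquare` with the number of all
vectors would give `q ^ (p + 1) = ±1`. -/
theorem exists_not_isSquare_dotProduct (hF : ringChar F ≠ 2) {p : ℕ}
    (hn : Fintype.card ι = 2 * (p + 1)) : ∃ z : ι → F, ¬ IsSquare (z ⬝ᵥ z) := by
  by_contra! hall
  have h := two_mul_ncard_isSquare hF hn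
  have hu : {z : ι → F | IsSquare (z ⬝ᵥ z)} = Set.univ := Set.eq_univ_of_forall hall
  rw [hu, Set.ncard_univ, Nat.card_eq_fintype_card, Fintype.card_fun, hn] at h
  have he : (quadraticChar F (-1) ^ (p + 1)) ^ 2 = 1 := by
    rw [← pow_mul, mul_comm, pow_mul, quadraticChar_sq_one (by simp), one_pow]
  have hq : (1 : ℤ) < Fintype.card F := by exact_mod_cast Fintype.one_lt_card
  have hqp : (1 : ℤ) < (Fintype.card F : ℤ) ^ (p + 1) := one_lt_pow₀ hq (Nat.succ_ne_zero p)
  push_cast at h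
  generalize quadraticChar F (-1) ^ (p + 1) = e at h he
  generalize (Fintype.card F : ℤ) = q at *
  have h0 : q ^ p * (q - 1) * (q ^ (p + 1) - e) = 0 := by linear_combination h
  have h1 : q ^ p * (q - 1) ≠ 0 := mul_ne_zero (pow_ne_zero _ (by omega)) (by omega)
  have h2 := (mul_eq_zero.mp h0).resolve_left h1
  nlinarith

end Counting

/-! ### Neighbourhoods in the graph -/

section Graph

variable {F : Type*} [Field F] {m : ℕ}

theorem sqDist_eq_dotProduct (x y : Fin m → F) : sqDist x y = (x - y) ⬝ᵥ (x - y) := by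
  simp [sqDist, dotProduct, sq]

theorem isSquare_sqDist_self (x : Fin m → F) : IsSquare (sqDist x x) := by
  simp [sqDist]

theorem commonNeighbors_of_not_isSquare {x y : Fin m → F} (h : ¬ IsSquare (sqDist x y)) :
    (integralGraph F m).commonNeighbors x y
      = {w | IsSquare (sqDist x w) ∧ IsSquare (sqDist y w)} := by
  ext w
  simp only [Set.mem_ofPred_eq, SimpleGraph.mem_commonNeighbors]
  refine ⟨fun h => ⟨h.1.2, h.2.2⟩, fun ⟨h1, h2⟩ => ⟨⟨?_, h1⟩, ⟨?_, h2⟩⟩⟩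
  · rintro rfl
    exact h (sqDist_comm x y ▸ h2)
  · rintro rfl
    exact h h1

/-- The points at square distance from both `x` and `y`, translated by `x`. -/
theorem ncard_isSquare_sqDist (x y : Fin m → F) :
    {w | IsSquare (sqDist x w) ∧ IsSquare (sqDist y w)}.ncard
      = {z : Fin m → F | IsSquare (z ⬝ᵥ z) ∧
          IsSquare ((x - y - z) ⬝ᵥ (x - y - z))}.ncard := by
  rw [← Set.ncard_image_of_injective {z : Fin m → F | IsSquare (z ⬝ᵥ z) ∧ _}
    (sub_right_injective (b := x))]
  congr 1
  ext w
  have h (w : Fin m → F) : sqDist y w = (x - y - (x - w)) ⬝ᵥ (x - y - (x - w)) := by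
    rw [sqDist_comm, sqDist_eq_dotProduct]; simp
  simp only [Set.mem_image, Set.mem_ofPred_eq]
  constructor
  · rintro ⟨h1, h2⟩
    exact ⟨x - w, ⟨by rwa [← sqDist_eq_dotProduct], by rwa [← h]⟩, sub_sub_cancel x w⟩
  · rintro ⟨z, ⟨h1, h2⟩, rfl⟩
    rw [h, sqDist_eq_dotProduct, sub_sub_cancel]
    exact ⟨h1, h2⟩

variable [Fintype F]

theorem ncard_neighborSet_add_one (x : Fin m → F) :
    ((integralGraph F m).neighborSet x).ncard + 1
      = {z : Fin m → F | IsSquare (z ⬝ᵥ z)}.ncard := by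
  rw [← Set.ncard_image_of_injective {z : Fin m → F | IsSquare (z ⬝ᵥ z)}
      (sub_right_injective (b := x)), ← Set.ncard_insert_of_notMem (a := x)
      (s := (integralGraph F m).neighborSet x) (by simp)]
  congr 1
  ext w
  simp only [Set.mem_insert_iff, SimpleGraph.mem_neighborSet, Set.mem_image, Set.mem_ofPred_eq]
  constructor
  · intro h
    refine ⟨x - w, ?_, sub_sub_cancel x w⟩
    rw [← sqDist_eq_dotProduct]
    rcases h with rfl | h
    exacts [isSquare_sqDist_self _, h.2]
  · rintro ⟨z, hz, rfl⟩
    by_cases h : x - z = x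
    · exact .inl h
    · exact .inr ⟨fun h' => h h'.symm, by rw [sqDist_eq_dotProduct, sub_sub_cancel]; exact hz⟩

theorem ncard_commonNeighbors_add_two {x y : Fin m → F} (h : (integralGraph F m).Adj x y) :
    ((integralGraph F m).commonNeighbors x y).ncard + 2
      = {w | IsSquare (sqDist x w) ∧ IsSquare (sqDist y w)}.ncard := by
  rw [show {w | IsSquare (sqDist x w) ∧ IsSquare (sqDist y w)}
    = insert x (insert y ((integralGraph F m).commonNeighbors x y)) from ?_,
    Set.ncard_insert_of_notMem, Set.ncard_insert_of_notMem]
  · simp [SimpleGraph.mem_commonNeighbors]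
  · simp [SimpleGraph.mem_commonNeighbors, h.1]
  · ext w
    simp only [Set.mem_ofPred_eq, Set.mem_insert_iff, SimpleGraph.mem_commonNeighbors]
    constructor
    · rintro ⟨h1, h2⟩
      by_cases hx : w = x
      · exact .inl hx
      by_cases hy : w = y
      · exact .inr (.inl hy)
      exact .inr (.inr ⟨⟨fun h => hx h.symm, h1⟩, ⟨fun h => hy h.symm, h2⟩⟩)
    · rintro (rfl | rfl | ⟨h1, h2⟩)
      · exact ⟨isSquare_sqDist_self _, h.symm.2⟩
      · exact ⟨h.2, isSquare_sqDist_self _⟩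
      · exact ⟨h1.2, h2.2⟩

end Graph

/-! ### The parameters -/

section Parameters

/-- For `m = 2 (p + 1)` both cases of the formula for `k` have one shape, up to the sign
`(±1) ^ (p + 1)`, which is `χ (-1) ^ (m / 2)` for the quadratic character `χ`. -/
theorem paramK_eq (p q : ℕ) : paramK (2 * (p + 1)) q
    = ((q : ℚ) ^ (2 * p + 1) * (q + 1)
      + (if q % 4 = 1 then 1 else -1) ^ (p + 1) * (q : ℚ) ^ p * (q - 1)) / 2 - 1 := by
  have h1 : 2 * (p + 1) - 1 = 2 * p + 1 := by omega
  have h2 : 2 * (p + 1) / 2 = p + 1 := by omega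
  rw [paramK, h1, h2, Nat.add_sub_cancel]
  split_ifs
  · ring
  · rw [neg_pow, neg_pow (q : ℚ) p]; ring

theorem paramLambda_eq (p : ℕ) {q : ℕ} (hq : Odd q) : paramLambda (2 * (p + 1)) q
    = ((q : ℚ) ^ (2 * p) * (q + 1) ^ 2
      + 2 * (if q % 4 = 1 then 1 else -1) ^ (p + 1) * (q : ℚ) ^ p * (q - 1)) / 4 - 2 := by
  have h1 : 2 * (p + 1) - 2 = 2 * p := by omega
  have h2 : 2 * (p + 1) / 2 = p + 1 := by omega
  have h3 : (-1 : ℚ) ^ (2 * (p + 1) * (q - 1) / 4)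
      = (if q % 4 = 1 then 1 else -1) ^ (p + 1) := by
    obtain ⟨r, rfl⟩ := hq
    rw [Nat.add_sub_cancel, show 2 * (p + 1) * (2 * r) = 4 * (r * (p + 1)) by ring,
      Nat.mul_div_cancel_left _ (by norm_num), pow_mul]
    congr 1
    split_ifs with h
    · exact Even.neg_one_pow (Nat.even_iff.mpr (by omega))
    · exact Odd.neg_one_pow (Nat.odd_iff.mpr (by omega))
  rw [paramLambda, h1, h2, h3, Nat.add_sub_cancel]
  ring

theorem paramMu_eq (p q : ℕ) : paramMu (2 * (p + 1)) q
    = ((q : ℚ) ^ (2 * p) * (q + 1) ^ 2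
      + 2 * (if q % 4 = 1 then 1 else -1) ^ (p + 1) * (q : ℚ) ^ p * (q + 1)) / 4 := by
  have h2 : 2 * (p + 1) / 2 = p + 1 := by omega
  rw [paramMu, h2, Nat.add_sub_cancel]
  split_ifs <;> ring

theorem quadraticChar_neg_one_eq_ite {F : Type*} [Field F] [Fintype F] [DecidableEq F]
    (hF : ringChar F ≠ 2) (hq : Odd (Fintype.card F)) :
    (quadraticChar F (-1) : ℚ) = if Fintype.card F % 4 = 1 then 1 else -1 := by
  rw [quadraticChar_neg_one hF]
  split_ifs with h
  · rw [ZMod.χ₄_nat_one_mod_four h, Int.cast_one]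
  · have := Nat.odd_iff.mp hq
    rw [ZMod.χ₄_nat_three_mod_four (by omega), Int.cast_neg, Int.cast_one]

end Parameters

end KurzMeyer

open KurzMeyer in
theorem mainTheorem1 {F : Type*} [Field F] [Fintype F] (q : ℕ) (hF : Fintype.card F = q)
    (hq : Odd q) (m : ℕ) (hm : Even m) (hm0 : 0 < m)
    [DecidableRel (KurzMeyer.integralGraph F m).Adj] :
    ∃ k l μ : ℕ,
      (k : ℚ) = KurzMeyer.paramK m q ∧
      (l : ℚ) = KurzMeyer.paramLambda m q ∧
      (μ : ℚ) = KurzMeyer.paramMu m q ∧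
      (KurzMeyer.integralGraph F m).IsSRGWith (q ^ m) k l μ := by
  classical
  subst hF
  obtain ⟨p, rfl⟩ : ∃ p, m = 2 * (p + 1) := by
    obtain ⟨n, rfl⟩ := hm
    exact ⟨n - 1, by omega⟩
  have h2 : ringChar F ≠ 2 := fun h => by
    have := FiniteField.even_card_iff_char_two.mp h
    have := Nat.odd_iff.mp hq
    omega
  have hχ := quadraticChar_neg_one_eq_ite h2 hq
  have hn : Fintype.card (Fin (2 * (p + 1))) = 2 * (p + 1) := Fintype.card_fin _
  have hk (x : Fin (2 * (p + 1)) → F) :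
      (((integralGraph F _).neighborSet x).ncard : ℚ) = paramK (2 * (p + 1)) (Fintype.card F) := by
    have h := two_mul_ncard_isSquare h2 hn
    rw [← ncard_neighborSet_add_one x] at h
    rw [paramK_eq]
    qify at h
    rw [hχ] at h
    linear_combination h / 2
  have hl (x y : Fin (2 * (p + 1)) → F) (hxy : (integralGraph F _).Adj x y) :
      (((integralGraph F _).commonNeighbors x y).ncard : ℚ)
        = paramLambda (2 * (p + 1)) (Fintype.card F) := by
    have h := four_mul_ncard_isSquare_and_isSquare h2 hn (sub_ne_zero.mpr hxy.1)
    rw [← ncard_isSquare_sqDist, ← ncard_commonNeighbors_add_two hxy,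
      if_pos (sqDist_eq_dotProduct x y ▸ hxy.2)] at h
    rw [paramLambda_eq p hq]
    qify at h
    rw [hχ] at h
    linear_combination h / 4
  have hμ (x y : Fin (2 * (p + 1)) → F) (hne : x ≠ y) (hxy : ¬ (integralGraph F _).Adj x y) :
      (((integralGraph F _).commonNeighbors x y).ncard : ℚ)
        = paramMu (2 * (p + 1)) (Fintype.card F) := by
    have hsq : ¬ IsSquare (sqDist x y) := fun h => hxy ⟨hne, h⟩
    have h := four_mul_ncard_isSquare_and_isSquare h2 hn (sub_ne_zero.mpr hne)
    rw [← ncard_isSquare_sqDist, ← commonNeighbors_of_not_isSquare hsq,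
      if_neg (sqDist_eq_dotProduct x y ▸ hsq)] at h
    rw [paramMu_eq]
    qify at h
    rw [hχ] at h
    linear_combination h / 4
  -- an adjacent pair and a distinct non-adjacent pair exist, so that `λ` and `μ` are themselves
  -- numbers of common neighbours.
  let u : Fin (2 * (p + 1)) → F := Pi.single 0 1
  have hu : (integralGraph F _).Adj u 0 :=
    ⟨fun h => one_ne_zero (α := F) (by simpa [u] using congrFun h 0), by
      simp [sqDist_eq_dotProduct, u]⟩
  obtain ⟨z, hz⟩ := exists_not_isSquare_dotProduct h2 hn
  have hz0 : z ≠ 0 := by rintro rfl; simp at hz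
  have hzadj : ¬ (integralGraph F _).Adj z 0 := fun h => hz <| by
    simpa [sqDist_eq_dotProduct] using h.2
  refine ⟨_, _, _, hk 0, hl u 0 hu, hμ z 0 hz0 hzadj, ⟨by simp, fun x => ?_, fun x y hxy => ?_,
    fun x y hne hxy => ?_⟩⟩
  · rw [← SimpleGraph.card_neighborSet_eq_degree, ← Nat.card_eq_fintype_card]
    exact_mod_cast (hk x).trans (hk 0).symm
  · rw [← Nat.card_eq_fintype_card]
    exact_mod_cast (hl x y hxy).trans (hl u 0 hu).symm
  · rw [← Nat.card_eq_fintype_card]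
    exact_mod_cast (hμ x y hne hxy).trans (hμ z 0 hz0 hzadj).symm
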